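/- The power graph $P(G)$ of a finite group $G$ is the undirected simple graph with vertex set $G$ in which two elements $a, b \in G$ are adjacent if and only if $a \neq b$ and $a^m = b$ or $b^m = a$ for some positive integer $m$. Let $\bar S$ denote the set of all positive integers $n$ such that any two groups of order $n$ with isomorphic power graphs are isomorphic. Proposition 2.1. If $p$ is an odd prime number, then $2p^2 \in \bar S$; that is, any two groups $G$ and $H$ of order $2p^2$ with $P(G) \cong P(H)$ (as graphs) satisfy $G \cong H$. -/

import Mathlib

universe u v

/-- The (undirected) power graph of a group `G`: the vertices are the elements of `G`, and two
distinct elements are adjacent iff one of them is a positive power of the other. -/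
def powerGraph (G : Type u) [Group G] : SimpleGraph G where
  Adj a b := a ≠ b ∧ ∃ m : ℕ, 0 < m ∧ (a ^ m = b ∨ b ^ m = a)
  symm := ⟨fun _ _ h => ⟨h.1.symm, h.2.imp fun _ hm => ⟨hm.1, hm.2.symm⟩⟩⟩
  loopless := ⟨fun _ h => h.1 rfl⟩

/-- The set of positive integers `n` such that any two finite groups of order `n` with
isomorphic power graphs are isomorphic. -/
def powerGraphOrders : Set ℕ :=
  {n | 0 < n ∧ ∀ (G : Type u) (H : Type v) [Group G] [Group H] [Finite G] [Finite H],
    Nat.card G = n → Nat.card H = n →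
      Nonempty (powerGraph G ≃g powerGraph H) → Nonempty (G ≃* H)}

/-! A group of order `2 * p ^ 2` has a Sylow `p`-subgroup `N` of index two, hence normal, and
abelian because its order is `p ^ 2`. With an involution `t` outside it, `G` is the semidirect
product of `N` and `⟨t⟩`. As `N` has odd order, conjugation by `t` splits it into a fixed and an
inverted part, and the fixed part is `center G ⊓ N`. So `G` is determined by whether `N` is cyclic
and whether the fixed part is trivial, proper nontrivial, or all of `N`.

The power graph sees all of this. `N` is cyclic iff there is a clique of size `p ^ 2`
(`not_cliqueFree_powerGraph_iff`). The fixed part is nontrivial iff all degrees exceed 1, and is all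
of `N` iff all degrees are at least `p`. -/

/-! ### Involutive automorphisms of abelian groups of odd order. -/

section Involution

variable {A : Type u} [CommGroup A]

/-- The elements fixed by an automorphism. -/
def fixedPart (σ : MulAut A) : Subgroup A := σ.toMonoidHom.eqLocus (MonoidHom.id A)

/-- The elements inverted by an automorphism of a commutative group. -/
def invertedPart (σ : MulAut A) : Subgroup A := σ.toMonoidHom.eqLocus invMonoidHom

theorem mem_fixedPart {σ : MulAut A} {a : A} : a ∈ fixedPart σ ↔ σ a = a := Iff.rfl

theorem mem_invertedPart {σ : MulAut A} {a : A} : a ∈ invertedPart σ ↔ σ a = a⁻¹ := Iff.rfl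

theorem eq_one_of_sq_eq_one_of_odd_card {B : Type*} [Group B] (hodd : Odd (Nat.card B)) {a : B}
    (ha : a ^ 2 = 1) : a = 1 := by
  rw [← orderOf_eq_one_iff]
  exact Nat.Coprime.eq_one_of_dvd (Nat.Coprime.coprime_dvd_left (orderOf_dvd_natCard a)
    (Nat.coprime_two_right.mpr hodd)) (orderOf_dvd_of_pow_eq_one ha)

theorem exists_sq_eq_of_odd_card {B : Type*} [Group B] (hodd : Odd (Nat.card B)) (a : B) :
    ∃ k : ℕ, (a ^ k) ^ 2 = a := by
  obtain ⟨k, hk⟩ := hodd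
  refine ⟨k + 1, ?_⟩
  rw [← pow_mul, show (k + 1) * 2 = Nat.card B + 1 by omega, pow_succ, pow_card_eq_one', one_mul]

/-- An involutive automorphism of a commutative group of odd order splits it into the fixed and
the inverted part. -/
theorem exists_fixedPart_prod_invertedPart_mulEquiv (hodd : Odd (Nat.card A)) (σ : MulAut A)
    (hσ : ∀ a, σ (σ a) = a) :
    ∃ e : fixedPart σ × invertedPart σ ≃* A, ∀ x, e x = x.1 * x.2 := by
  have hb : Function.Bijective ((fixedPart σ).subtype.coprod (invertedPart σ).subtype) := by
    constructor
    · rw [injective_iff_map_eq_one]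
      rintro ⟨⟨c, hc⟩, ⟨d, hd⟩⟩ h
      simp only [MonoidHom.coprod_apply, Subgroup.subtype_apply] at h
      rw [mem_fixedPart] at hc
      rw [mem_invertedPart] at hd
      have hcd : c = d⁻¹ := eq_inv_of_mul_eq_one_left h
      subst hcd
      have hd1 : d = 1 := by
        apply eq_one_of_sq_eq_one_of_odd_card hodd
        rw [map_inv, hd, inv_inv] at hc
        rw [sq]
        nth_rw 1 [hc]
        simp
      subst hd1
      simp
    · intro a
      obtain ⟨k, hk⟩ := exists_sq_eq_of_odd_card hodd a
      set b := a ^ k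
      -- Here `b` is a square root of `a`, and the two factors multiply to `b ^ 2`.
      refine ⟨(⟨b * σ b, ?_⟩, ⟨b * (σ b)⁻¹, ?_⟩), ?_⟩
      · rw [mem_fixedPart, map_mul, hσ, mul_comm]
      · rw [mem_invertedPart, map_mul, map_inv, hσ, mul_inv, inv_inv, mul_comm]
      · simp only [MonoidHom.coprod_apply, Subgroup.subtype_apply]
        rw [mul_mul_mul_comm, mul_inv_cancel, mul_one, ← sq, hk]
  exact ⟨MulEquiv.ofBijective _ hb, fun x => rfl⟩

theorem exists_mulEquiv_comm_of_parts {B : Type v} [CommGroup B] (hA : Odd (Nat.card A))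
    (hB : Odd (Nat.card B)) {σ : MulAut A} {τ : MulAut B} (hσ : ∀ a, σ (σ a) = a)
    (hτ : ∀ b, τ (τ b) = b) (f : fixedPart σ ≃* fixedPart τ)
    (g : invertedPart σ ≃* invertedPart τ) : ∃ φ : A ≃* B, ∀ a, φ (σ a) = τ (φ a) := by
  obtain ⟨e, he⟩ := exists_fixedPart_prod_invertedPart_mulEquiv hA σ hσ
  obtain ⟨e', he'⟩ := exists_fixedPart_prod_invertedPart_mulEquiv hB τ hτ
  refine ⟨(e.symm.trans (MulEquiv.prodCongr f g)).trans e', fun a => ?_⟩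
  obtain ⟨⟨c, d⟩, rfl⟩ := e.surjective a
  have h : σ (e (c, d)) = e (c, d⁻¹) := by
    rw [he, he, map_mul, mem_fixedPart.1 c.2, mem_invertedPart.1 d.2]
    rfl
  rw [h]
  simp only [MulEquiv.trans_apply, MulEquiv.symm_apply_apply, he', map_mul]
  change (f c : B) * (g d⁻¹ : B) = τ (f c : B) * τ (g d : B)
  rw [mem_fixedPart.1 (f c).2, mem_invertedPart.1 (g d).2, map_inv]
  rfl

theorem apply_eq_inv_of_fixedPart_eq_bot {σ : MulAut A}
    (hσ : ∀ a, σ (σ a) = a) (h : fixedPart σ = ⊥) (a : A) : σ a = a⁻¹ := by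
  have : a * σ a ∈ fixedPart σ := by rw [mem_fixedPart, map_mul, hσ, mul_comm]
  rw [h, Subgroup.mem_bot] at this
  exact eq_inv_of_mul_eq_one_right this

theorem card_parts_eq_prime {p : ℕ} (hp : p.Prime) (hodd : Odd p) (hA : Nat.card A = p ^ 2)
    {σ : MulAut A} (hσ : ∀ a, σ (σ a) = a) (hbot : fixedPart σ ≠ ⊥) (htop : fixedPart σ ≠ ⊤) :
    Nat.card (fixedPart σ) = p ∧ Nat.card (invertedPart σ) = p := by
  have : Finite A := Nat.finite_of_card_ne_zero (by rw [hA]; exact pow_ne_zero _ hp.ne_zero)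
  obtain ⟨e, -⟩ := exists_fixedPart_prod_invertedPart_mulEquiv (hA ▸ hodd.pow) σ hσ
  have hcard := Nat.card_congr e.toEquiv
  rw [Nat.card_prod, hA] at hcard
  obtain ⟨i, hi, h⟩ := (Nat.dvd_prime_pow hp).1 (hA ▸ Subgroup.card_subgroup_dvd_card (fixedPart σ))
  have h1 : Nat.card (fixedPart σ) = p := by
    interval_cases i
    · exact absurd (Subgroup.card_eq_one.1 (by simpa using h)) hbot
    · simpa using h
    · exact absurd (Subgroup.card_eq_iff_eq_top _ |>.1 (h.trans hA.symm)) htop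
  refine ⟨h1, ?_⟩
  rw [h1, sq] at hcard
  exact Nat.eq_of_mul_eq_mul_left hp.pos hcard

/-- In the mixed case the group is a product of two groups of order `p`, so it has exponent `p`. -/
theorem pow_prime_eq_one_of_parts {p : ℕ} (hp : p.Prime) (hodd : Odd p) (hA : Nat.card A = p ^ 2)
    {σ : MulAut A} (hσ : ∀ a, σ (σ a) = a) (hbot : fixedPart σ ≠ ⊥) (htop : fixedPart σ ≠ ⊤)
    (a : A) : a ^ p = 1 := by
  obtain ⟨h1, h2⟩ := card_parts_eq_prime hp hodd hA hσ hbot htop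
  obtain ⟨e, -⟩ := exists_fixedPart_prod_invertedPart_mulEquiv (hA ▸ hodd.pow) σ hσ
  obtain ⟨⟨c, d⟩, rfl⟩ := e.surjective a
  rw [← map_pow, Prod.pow_mk, ← h1, pow_card_eq_one', h1, ← h2, pow_card_eq_one', ← Prod.one_eq_mk,
    map_one]

end Involution

/-! ### Semidirect products with a group of order two. -/

section Extension

variable {G : Type u} {H : Type v} [Group G] [Group H]

theorem eq_one_or_eq_of_mem_zpowers_of_sq_eq_one {t x : G} (ht2 : t ^ 2 = 1)
    (hx : x ∈ Subgroup.zpowers t) : x = 1 ∨ x = t := by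
  obtain ⟨k, rfl⟩ := hx
  have ht2' : t ^ (2 : ℤ) = 1 := by exact_mod_cast ht2
  rcases Int.even_or_odd' k with ⟨m, rfl | rfl⟩
  · left
    simp [zpow_mul, ht2']
  · right
    simp [zpow_add, zpow_mul, ht2']

theorem isComplement'_zpowers_of_index_two [Finite G] {N : Subgroup G} (hN : N.index = 2) {t : G}
    (ht : t ∉ N) (ht2 : t ^ 2 = 1) : N.IsComplement' (Subgroup.zpowers t) := by
  have ht1 : t ≠ 1 := fun h => ht (h ▸ N.one_mem)
  have ho : orderOf t = 2 := orderOf_eq_prime ht2 ht1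
  apply Subgroup.isComplement'_of_card_mul_and_disjoint
  · rw [Nat.card_zpowers, ho, ← hN, Subgroup.card_mul_index]
  · rw [Subgroup.disjoint_def]
    intro x hx hxt
    rcases eq_one_or_eq_of_mem_zpowers_of_sq_eq_one ht2 hxt with rfl | rfl
    · rfl
    · exact absurd hx ht

/-- An isomorphism between normal subgroups of index two, compatible with conjugation by
involutions outside these subgroups, extends to the groups. -/
theorem nonempty_mulEquiv_of_index_two [Finite G] [Finite H] {N : Subgroup G} {M : Subgroup H}
    [N.Normal] [M.Normal] (hN : N.index = 2) (hM : M.index = 2) {t : G} {s : H} (ht : t ∉ N)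
    (hs : s ∉ M) (ht2 : t ^ 2 = 1) (hs2 : s ^ 2 = 1) (φ : N ≃* M)
    (hφ : ∀ n, φ (MulAut.conjNormal t n) = MulAut.conjNormal s (φ n)) : Nonempty (G ≃* H) := by
  have ot : orderOf t = 2 := orderOf_eq_prime ht2 fun h => ht (h ▸ N.one_mem)
  have os : orderOf s = 2 := orderOf_eq_prime hs2 fun h => hs (h ▸ M.one_mem)
  have : Fact (Nat.Prime 2) := ⟨Nat.prime_two⟩
  let ψ : Subgroup.zpowers t ≃* Subgroup.zpowers s :=
    mulEquivOfPrimeCardEq (p := 2) (by rw [Nat.card_zpowers, ot]) (by rw [Nat.card_zpowers, os])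
  refine ⟨((SemidirectProduct.mulEquivSubgroup
    (isComplement'_zpowers_of_index_two hN ht ht2)).symm.trans
    (SemidirectProduct.congr φ ψ ?_)).trans (SemidirectProduct.mulEquivSubgroup
    (isComplement'_zpowers_of_index_two hM hs hs2))⟩
  rintro ⟨x, hx⟩
  ext n
  rcases eq_one_or_eq_of_mem_zpowers_of_sq_eq_one ht2 hx with rfl | rfl
  · rw [show (⟨1, hx⟩ : Subgroup.zpowers t) = 1 from rfl]
    simp
  -- Although `ψ` is chosen abstractly, an isomorphism of groups of order two must match the
  -- generators.
  · have hψ : ψ ⟨x, hx⟩ = ⟨s, Subgroup.mem_zpowers s⟩ := by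
      rcases eq_one_or_eq_of_mem_zpowers_of_sq_eq_one hs2 (ψ ⟨x, hx⟩).2 with h | h
      · rw [OneMemClass.coe_eq_one, map_eq_one_iff ψ ψ.injective] at h
        have h1 : x = 1 := congrArg Subtype.val h
        exact absurd (h1 ▸ N.one_mem) ht
      · exact Subtype.ext h
    rw [hψ]
    exact congrArg Subtype.val (hφ n)

end Extension

/-! ### Elementary abelian groups as vector spaces over `ZMod p`. -/

theorem nonempty_addEquiv_of_zmod_module {A : Type u} {B : Type v} [AddCommGroup A]
    [AddCommGroup B] [Finite A] [Finite B] {p : ℕ} [Fact p.Prime] [Module (ZMod p) A]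
    [Module (ZMod p) B] (h : Nat.card A = Nat.card B) : Nonempty (A ≃+ B) := by
  have hr : Module.finrank (ZMod p) A = Module.finrank (ZMod p) B := by
    apply Nat.pow_right_injective (Nat.card_zmod p ▸ (Fact.out : p.Prime).two_le)
    change Nat.card (ZMod p) ^ _ = Nat.card (ZMod p) ^ _
    rw [← Module.natCard_eq_pow_finrank, ← Module.natCard_eq_pow_finrank, h]
  obtain ⟨e⟩ := FiniteDimensional.nonempty_linearEquiv_of_finrank_eq hr
  exact ⟨e.toAddEquiv⟩

theorem nonempty_mulEquiv_of_pow_prime_eq_one {A : Type u} {B : Type v} [CommGroup A] [CommGroup B]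
    [Finite A] [Finite B] {p : ℕ} [Fact p.Prime] (hA : ∀ a : A, a ^ p = 1)
    (hB : ∀ b : B, b ^ p = 1) (h : Nat.card A = Nat.card B) : Nonempty (A ≃* B) := by
  have mA : Module (ZMod p) (Additive A) := AddCommGroup.zmodModule hA
  have mB : Module (ZMod p) (Additive B) := AddCommGroup.zmodModule hB
  obtain ⟨e⟩ := nonempty_addEquiv_of_zmod_module (A := Additive A) (B := Additive B) (p := p) h
  exact ⟨MulEquiv.toAdditive.symm e⟩

/-! ### Adjacency and cliques in the power graph. -/

section PowerGraph

variable {G : Type u} [Group G] [Finite G]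

theorem powerGraph_adj_of_mem_zpowers {x y : G} (hxy : x ≠ y) (h : y ∈ Subgroup.zpowers x) :
    (powerGraph G).Adj x y := by
  rw [← mem_powers_iff_mem_zpowers] at h
  obtain ⟨m, rfl⟩ := h
  -- `m` may be zero; adding the order makes the exponent positive.
  refine ⟨hxy, m + orderOf x, Nat.add_pos_right _ (orderOf_pos x), Or.inl ?_⟩
  simp [pow_add]

theorem powerGraph_adj_iff {x y : G} : (powerGraph G).Adj x y ↔
    x ≠ y ∧ (y ∈ Subgroup.zpowers x ∨ x ∈ Subgroup.zpowers y) := by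
  constructor
  · rintro ⟨hne, m, -, rfl | rfl⟩
    · exact ⟨hne, Or.inl (Subgroup.npow_mem_zpowers x m)⟩
    · exact ⟨hne, Or.inr (Subgroup.npow_mem_zpowers y m)⟩
  · rintro ⟨hne, h | h⟩
    · exact powerGraph_adj_of_mem_zpowers hne h
    · exact (powerGraph_adj_of_mem_zpowers hne.symm h).symm

theorem zpowers_eq_of_mem_of_orderOf_le {x y : G} (h : y ∈ Subgroup.zpowers x)
    (ho : orderOf x ≤ orderOf y) : Subgroup.zpowers y = Subgroup.zpowers x := by
  apply Subgroup.eq_of_le_of_card_ge (Subgroup.zpowers_le.2 h)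
  rwa [Nat.card_zpowers, Nat.card_zpowers]

/-- A clique of the power graph is contained in a cyclic subgroup. -/
theorem exists_subset_zpowers_of_isClique {s : Finset G} (hs : (powerGraph G).IsClique s)
    (hne : s.Nonempty) : ∃ x : G, (s : Set G) ⊆ Subgroup.zpowers x := by
  obtain ⟨x, hx, hmax⟩ := s.exists_max_image orderOf hne
  refine ⟨x, fun y hy => ?_⟩
  rcases eq_or_ne x y with rfl | hxy
  · exact Subgroup.mem_zpowers x
  rcases (powerGraph_adj_iff.1 (hs hx hy hxy)).2 with h | h
  · exact h
  · exact zpowers_eq_of_mem_of_orderOf_le h (hmax y hy) ▸ Subgroup.mem_zpowers y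

/-- The subgroups of a cyclic group of order `p ^ 2` form a chain; hence its elements form a clique.
-/
theorem mem_zpowers_or_of_orderOf_eq_prime_sq {p : ℕ} (hp : p.Prime) {g a b : G}
    (hg : orderOf g = p ^ 2) (ha : a ∈ Subgroup.zpowers g) (hb : b ∈ Subgroup.zpowers g) :
    b ∈ Subgroup.zpowers a ∨ a ∈ Subgroup.zpowers b := by
  have key : ∀ c ∈ Subgroup.zpowers g, c = 1 ∨ Subgroup.zpowers c = Subgroup.zpowers g ∨
      Subgroup.zpowers c = Subgroup.zpowers (g ^ p) := by
    intro c hc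
    have hdvd := orderOf_dvd_of_mem_zpowers hc
    rw [hg, Nat.dvd_prime_pow hp] at hdvd
    obtain ⟨i, hi, h⟩ := hdvd
    have hgp : orderOf (g ^ p) = p := by
      rw [orderOf_pow' _ hp.ne_zero, hg, sq, Nat.gcd_mul_left_left, Nat.mul_div_cancel _ hp.pos]
    interval_cases i
    · left
      exact orderOf_eq_one_iff.1 (by simpa using h)
    · right; right
      rw [← mem_powers_iff_mem_zpowers] at hc
      obtain ⟨k, rfl⟩ := hc
      simp only [pow_one] at h ⊢
      apply zpowers_eq_of_mem_of_orderOf_le _ (by rw [h, hgp])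
      have hk : p ∣ k := by
        have h1 := pow_orderOf_eq_one (g ^ k)
        rw [h, ← pow_mul, ← orderOf_dvd_iff_pow_eq_one, hg, sq] at h1
        exact Nat.dvd_of_mul_dvd_mul_right hp.pos h1
      obtain ⟨j, rfl⟩ := hk
      rw [pow_mul]
      exact Subgroup.npow_mem_zpowers _ _
    · right; left
      exact zpowers_eq_of_mem_of_orderOf_le hc (by rw [h, hg])
  have hpg : g ^ p ∈ Subgroup.zpowers g := Subgroup.npow_mem_zpowers _ _
  rcases key a ha with rfl | h1 | h1
  · exact Or.inr (one_mem _)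
  · exact Or.inl (h1 ▸ hb)
  · rcases key b hb with rfl | h2 | h2
    · exact Or.inl (one_mem _)
    · exact Or.inr (h2 ▸ ha)
    · exact Or.inl (h1.trans h2.symm ▸ Subgroup.mem_zpowers b)

omit [Finite G] in
theorem orderOf_eq_prime_sq_or_le {p : ℕ} (hp : p.Prime) {N : Subgroup G} (hN : N.index = 2)
    (hcard : Nat.card N = p ^ 2) (x : G) :
    (∃ g : G, orderOf g = p ^ 2) ∨ orderOf x ≤ 2 * p := by
  have hx : x ^ 2 ∈ N := Subgroup.sq_mem_of_index_two hN x
  have hdvd : orderOf (x ^ 2) ∣ p ^ 2 := hcard ▸ Subgroup.orderOf_dvd_natCard N hx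
  rw [Nat.dvd_prime_pow hp] at hdvd
  obtain ⟨i, hi, h⟩ := hdvd
  have hle : i ≤ 1 → orderOf x ≤ 2 * p := fun hi => by
    apply orderOf_le_of_pow_eq_one (by have := hp.pos; omega)
    rw [pow_mul]
    apply orderOf_dvd_iff_pow_eq_one.1
    rw [h]
    simpa using pow_dvd_pow p hi
  rcases Nat.lt_or_ge 1 i with h2 | h2
  · obtain rfl : i = 2 := by omega
    exact Or.inl ⟨_, h⟩
  · exact Or.inr (hle h2)

theorem not_cliqueFree_powerGraph_iff {p : ℕ} (hp : p.Prime) (hodd : Odd p) {N : Subgroup G}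
    (hN : N.index = 2) (hcard : Nat.card N = p ^ 2) :
    ¬ (powerGraph G).CliqueFree (p ^ 2) ↔ ∃ g : G, orderOf g = p ^ 2 := by
  have hp3 : 3 ≤ p := by
    have := hp.two_le
    rcases hodd with ⟨k, rfl⟩
    omega
  constructor
  · intro h
    simp only [SimpleGraph.CliqueFree, not_forall, not_not] at h
    obtain ⟨s, hs⟩ := h
    obtain ⟨x, hx⟩ := exists_subset_zpowers_of_isClique hs.1
      (Finset.card_pos.1 (hs.2 ▸ pow_pos hp.pos 2))
    refine (orderOf_eq_prime_sq_or_le hp hN hcard x).resolve_right fun hle => ?_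
    have := Set.ncard_le_ncard hx
    rw [Set.ncard_coe_finset, hs.2] at this
    change _ ≤ Nat.card (Subgroup.zpowers x) at this
    rw [Nat.card_zpowers] at this
    -- A cyclic subgroup of order at most `2 * p` is too small, since `p ≥ 3` gives `2 * p < p ^ 2`.
    nlinarith
  · rintro ⟨g, hg⟩ hfree
    classical
    have : Fintype G := Fintype.ofFinite G
    refine hfree (Subgroup.zpowers g : Set G).toFinset ⟨?_, ?_⟩
    · intro a ha b hb hab
      rw [Finset.mem_coe, Set.mem_toFinset] at ha hb
      exact powerGraph_adj_iff.2 ⟨hab, mem_zpowers_or_of_orderOf_eq_prime_sq hp hg ha hb⟩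
    · rw [Set.toFinset_card, ← Nat.card_eq_fintype_card, ← hg, ← Nat.card_zpowers]
      rfl

theorem ncard_neighborSet_eq_of_iso {V : Type u} {W : Type v} {A : SimpleGraph V}
    {B : SimpleGraph W} (e : A ≃g B) (x : V) :
    (B.neighborSet (e x)).ncard = (A.neighborSet x).ncard :=
  (Nat.card_congr (e.mapNeighborSet x)).symm

end PowerGraph

/-! ### Degrees and the central part of `N`. -/

section Degree

variable {G : Type u} [Group G]

theorem mem_center_of_index_two {N : Subgroup G} (hN : N.index = 2)
    (hcomm : ∀ a ∈ N, ∀ b ∈ N, a * b = b * a) {t n : G} (ht : t ∉ N) (hn : n ∈ N)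
    (h : t * n = n * t) : n ∈ Subgroup.center G := by
  rw [Subgroup.mem_center_iff]
  intro g
  by_cases hg : g ∈ N
  · exact hcomm g hg n hn
  · have hk : t⁻¹ * g ∈ N := by
      rw [Subgroup.mul_mem_iff_of_index_two hN, inv_mem_iff]
      exact iff_of_false ht hg
    have := hcomm _ hk _ hn
    calc g * n = t * (t⁻¹ * g * n) := by group
      _ = t * n * (t⁻¹ * g) := by rw [this]; group
      _ = n * g := by rw [h]; group

variable [Finite G]

theorem ncard_neighborSet_le_one {N : Subgroup G} (hN : N.index = 2)
    (hcomm : ∀ a ∈ N, ∀ b ∈ N, a * b = b * a) (hbot : Subgroup.center G ⊓ N = ⊥) {t : G}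
    (ht : t ∉ N) (ht2 : t ^ 2 = 1) : ((powerGraph G).neighborSet t).ncard ≤ 1 := by
  have hsub : (powerGraph G).neighborSet t ⊆ {1} := by
    intro y hy
    rw [SimpleGraph.mem_neighborSet, powerGraph_adj_iff] at hy
    obtain ⟨hne, h | h⟩ := hy
    · exact (eq_one_or_eq_of_mem_zpowers_of_sq_eq_one ht2 h).resolve_right hne.symm
    · exfalso
      have hyN : y ∉ N := fun hyN => ht (Subgroup.zpowers_le.2 hyN h)
      -- `y ^ 2` commutes with `y` and with `N`, which generate `G`. Being trivial, it makes `y` an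
      -- involution, so `t` can only be `1` or `y`.
      have hy2 : y ^ 2 ∈ Subgroup.center G ⊓ N :=
        ⟨mem_center_of_index_two hN hcomm hyN (Subgroup.sq_mem_of_index_two hN y)
          (Commute.self_pow y 2), Subgroup.sq_mem_of_index_two hN y⟩
      rw [hbot, Subgroup.mem_bot] at hy2
      rcases eq_one_or_eq_of_mem_zpowers_of_sq_eq_one hy2 h with h | h
      · exact ht (h ▸ N.one_mem)
      · exact hne h
  exact (Set.ncard_le_ncard hsub).trans (Set.ncard_singleton _).le

omit [Finite G] in
theorem mem_zpowers_mul_of_mem_center {x c : G} {k : ℕ} (hk : Odd k) (hx : x ^ 2 = 1)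
    (hc : c ∈ Subgroup.center G) (hck : c ^ k = 1) : x ∈ Subgroup.zpowers (x * c) := by
  refine Subgroup.mem_zpowers_iff.2 ⟨k, ?_⟩
  obtain ⟨m, rfl⟩ := hk
  rw [zpow_natCast, Commute.mul_pow (Subgroup.mem_center_iff.1 hc x), hck, pow_succ, pow_mul, hx]
  simp

/-- For a nontrivial central `c` in `N`, two neighbours are `c, c⁻¹` if `x = 1`, `1, x * c` if `x`
is an involution, and `1, x⁻¹` otherwise. -/
theorem one_lt_ncard_neighborSet {N : Subgroup G}
    (hodd : Odd (Nat.card N)) (hbot : Subgroup.center G ⊓ N ≠ ⊥) (x : G) :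
    1 < ((powerGraph G).neighborSet x).ncard := by
  rw [Set.one_lt_ncard]
  have hsq : ∀ y ∈ N, y ^ 2 = 1 → y = 1 := fun y hy h =>
    congrArg Subtype.val (eq_one_of_sq_eq_one_of_odd_card hodd (a := (⟨y, hy⟩ : N))
      (Subtype.ext h))
  obtain ⟨⟨c, hcZ, hcN⟩, hc⟩ := Subgroup.ne_bot_iff_exists_ne_one.1 hbot
  have hc1 : c ≠ 1 := fun h => hc (Subtype.ext h)
  by_cases hx1 : x = 1
  · subst hx1
    refine ⟨c, ?_, c⁻¹, ?_, ?_⟩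
    · exact powerGraph_adj_iff.2 ⟨hc1.symm, Or.inr (one_mem _)⟩
    · exact powerGraph_adj_iff.2 ⟨(inv_ne_one.2 hc1).symm, Or.inr (one_mem _)⟩
    · intro h
      exact hc1 (hsq c hcN (by rw [sq]; nth_rw 2 [h]; simp))
  have h1 : (1 : G) ∈ (powerGraph G).neighborSet x :=
    powerGraph_adj_iff.2 ⟨hx1, Or.inl (one_mem _)⟩
  by_cases hx2 : x ^ 2 = 1
  · refine ⟨1, h1, x * c, powerGraph_adj_iff.2 ⟨?_, Or.inr ?_⟩, ?_⟩
    · simpa using hc1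
    · exact mem_zpowers_mul_of_mem_center hodd hx2 hcZ (by
        exact congrArg Subtype.val (pow_card_eq_one' (x := (⟨c, hcN⟩ : N))))
    · intro h
      have : x = c⁻¹ := eq_inv_of_mul_eq_one_left h.symm
      exact hx1 (hsq x (this ▸ N.inv_mem hcN) hx2)
  · refine ⟨1, h1, x⁻¹, powerGraph_adj_iff.2 ⟨?_, Or.inl (inv_mem (Subgroup.mem_zpowers x))⟩, ?_⟩
    · intro h
      exact hx2 (by rw [sq]; nth_rw 2 [h]; simp)
    · exact (inv_ne_one.2 hx1).symm

theorem prime_le_ncard_neighborSet {p : ℕ} (hp : p.Prime) (hodd : Odd p) {N : Subgroup G}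
    (hN : N.index = 2) (hcard : Nat.card N = p ^ 2) (hle : N ≤ Subgroup.center G) {t : G}
    (ht : t ∉ N) (ht2 : t ^ 2 = 1) (x : G) : p ≤ ((powerGraph G).neighborSet x).ncard := by
  have hncard : ∀ K : Subgroup G, (K : Set G).ncard = Nat.card K := fun K => rfl
  have horder : ∀ y ∈ N, y ≠ 1 → p ≤ orderOf y := fun y hy hy1 => by
    have hdvd : orderOf y ∣ p ^ 2 := hcard ▸ Subgroup.orderOf_dvd_natCard N hy
    rw [Nat.dvd_prime_pow hp] at hdvd
    obtain ⟨i, hi, h⟩ := hdvd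
    rw [h]
    apply Nat.le_self_pow
    rintro rfl
    exact hy1 (orderOf_eq_one_iff.1 (by simpa using h))
  have hN1 : p ≤ ((N : Set G) \ {1}).ncard := by
    rw [Set.ncard_sdiff_singleton_of_mem N.one_mem, hncard, hcard]
    have := hp.two_le
    exact Nat.le_sub_one_of_lt (by nlinarith)
  have hoddN : Odd (Nat.card N) := hcard ▸ hodd.pow
  have hpow : ∀ n ∈ N, n ^ Nat.card N = 1 := fun n hn =>
    congrArg Subtype.val (pow_card_eq_one' (x := (⟨n, hn⟩ : N)))
  by_cases hxN : x ∈ N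
  · by_cases hx1 : x = 1
    · subst hx1
      refine hN1.trans (Set.ncard_le_ncard fun y hy => ?_)
      exact powerGraph_adj_iff.2 ⟨fun h => hy.2 h.symm, Or.inr (one_mem _)⟩
    · have htx : x * t ∉ N := fun h => ht ((N.mul_mem_cancel_left hxN).1 h)
      -- If `x` has order `p`, its cyclic group gives only `p - 1` neighbours; `x * t` supplies the
      -- missing one, its power with even exponent `Nat.card N + 1` being `x`.
      have hsub : insert (x * t) ((Subgroup.zpowers x : Set G) \ {x}) ⊆
          (powerGraph G).neighborSet x := by
        rintro y (rfl | ⟨hy, hyx⟩)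
        · refine powerGraph_adj_iff.2 ⟨fun h => htx (h ▸ hxN), Or.inr ?_⟩
          refine Subgroup.mem_zpowers_iff.2 ⟨(Nat.card N + 1 : ℕ), ?_⟩
          rw [zpow_natCast, Commute.mul_pow (Subgroup.mem_center_iff.1 (hle hxN) t).symm, pow_succ,
            hpow x hxN]
          obtain ⟨m, hm⟩ := hoddN
          rw [hm, show 2 * m + 1 + 1 = 2 * (m + 1) by ring, pow_mul, ht2]
          simp
        · exact powerGraph_adj_iff.2 ⟨Ne.symm hyx, Or.inl hy⟩
      refine le_trans ?_ (Set.ncard_le_ncard hsub)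
      rw [Set.ncard_insert_of_notMem fun h => htx (Subgroup.zpowers_le.2 hxN h.1),
        Set.ncard_sdiff_singleton_of_mem (Subgroup.mem_zpowers x), hncard, Nat.card_zpowers]
      have := horder x hxN hx1
      omega
  · by_cases hx2 : x ^ 2 = 1
    · have hsub : (x * ·) '' ((N : Set G) \ {1}) ⊆ (powerGraph G).neighborSet x := by
        rintro _ ⟨n, ⟨hn, hn1⟩, rfl⟩
        refine powerGraph_adj_iff.2 ⟨?_, Or.inr ?_⟩
        · simpa using hn1
        · exact mem_zpowers_mul_of_mem_center hoddN hx2 (hle hn) (hpow n hn)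
      refine le_trans ?_ (Set.ncard_le_ncard hsub)
      rwa [Set.ncard_image_of_injective _ (mul_right_injective x)]
    · have hsq := Subgroup.sq_mem_of_index_two hN x
      have hsub : (Subgroup.zpowers (x ^ 2) : Set G) ⊆ (powerGraph G).neighborSet x := by
        intro y hy
        refine powerGraph_adj_iff.2 ⟨?_, Or.inl ?_⟩
        · rintro rfl
          exact hxN (Subgroup.zpowers_le.2 hsq hy)
        · exact Subgroup.zpowers_le.2 (Subgroup.npow_mem_zpowers x 2) hy
      refine le_trans ?_ (Set.ncard_le_ncard hsub)
      rw [hncard, Nat.card_zpowers]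
      exact horder _ hsq hx2

/-- A `y` outside `N` with `x` among its powers would commute with `x` and make it central. So all
neighbours lie in `⟨x⟩`, of order `p`. -/
theorem ncard_neighborSet_lt_prime {p : ℕ} (hp : p.Prime) {N : Subgroup G}
    (hN : N.index = 2) (hcomm : ∀ a ∈ N, ∀ b ∈ N, a * b = b * a) (hpow : ∀ a ∈ N, a ^ p = 1)
    {x : G} (hxN : x ∈ N) (hxZ : x ∉ Subgroup.center G) :
    ((powerGraph G).neighborSet x).ncard < p := by
  have : Fact p.Prime := ⟨hp⟩
  have hx1 : x ≠ 1 := by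
    rintro rfl
    exact hxZ (one_mem _)
  have hox := orderOf_eq_prime (hpow x hxN) hx1
  have hsub : (powerGraph G).neighborSet x ⊆ (Subgroup.zpowers x : Set G) \ {x} := by
    intro y hy
    rw [SimpleGraph.mem_neighborSet, powerGraph_adj_iff] at hy
    refine ⟨?_, hy.1.symm⟩
    rcases hy.2 with h | h
    · exact h
    · have hyN : y ∈ N := by
        by_contra hyN
        refine hxZ (mem_center_of_index_two hN hcomm hyN hxN ?_)
        obtain ⟨k, rfl⟩ := h
        exact Commute.self_zpow y k
      have hle : orderOf y ≤ orderOf x := by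
        rw [hox]
        exact orderOf_le_of_pow_eq_one hp.pos (hpow y hyN)
      exact zpowers_eq_of_mem_of_orderOf_le h hle ▸ Subgroup.mem_zpowers y
  refine (Set.ncard_le_ncard hsub).trans_lt ?_
  rw [Set.ncard_sdiff_singleton_of_mem (Subgroup.mem_zpowers x)]
  change Nat.card (Subgroup.zpowers x) - 1 < p
  rw [Nat.card_zpowers, hox]
  exact Nat.sub_lt hp.pos one_pos

end Degree

/-! ### Groups of order `2 * p ^ 2`. -/

section TwoPrimeSquare

theorem exists_index_two_and_involution {G : Type u} [Group G] [Finite G] {p : ℕ} (hp : p.Prime)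
    (hodd : Odd p) (hG : Nat.card G = 2 * p ^ 2) :
    ∃ N : Subgroup G, N.index = 2 ∧ Nat.card N = p ^ 2 ∧ ∃ t, t ∉ N ∧ t ^ 2 = 1 := by
  have : Fact p.Prime := ⟨hp⟩
  have : Fact (Nat.Prime 2) := ⟨Nat.prime_two⟩
  obtain ⟨N, hN⟩ := Sylow.exists_subgroup_card_pow_prime (G := G) p (n := 2)
    (hG ▸ Dvd.intro_left 2 rfl)
  obtain ⟨t, ht⟩ := exists_prime_orderOf_dvd_card' (G := G) 2 (hG ▸ Dvd.intro _ rfl)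
  refine ⟨N, ?_, hN, t, fun h => ?_, ht ▸ pow_orderOf_eq_one t⟩
  · have := N.card_mul_index
    rw [hN, hG, mul_comm] at this
    exact Nat.eq_of_mul_eq_mul_right (pow_pos hp.pos 2) this
  · have h2 := Subgroup.orderOf_dvd_natCard N h
    rw [ht, hN] at h2
    exact (Nat.not_even_iff_odd.2 hodd) (even_iff_two_dvd.2 (Nat.prime_two.dvd_of_dvd_pow h2))

open scoped IsMulCommutative

variable {G : Type u} [Group G] {N : Subgroup G} [N.Normal] [IsMulCommutative N]

omit [IsMulCommutative N] in
theorem conjNormal_conjNormal_of_sq_eq_one {t : G} (ht2 : t ^ 2 = 1) (a : N) :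
    MulAut.conjNormal t (MulAut.conjNormal t a) = a := by
  rw [← MulAut.mul_apply, ← map_mul, ← sq, ht2, map_one, MulAut.one_apply]

theorem mem_fixedPart_conjNormal_iff (hN : N.index = 2) {t : G} (ht : t ∉ N) (n : N) :
    n ∈ fixedPart (MulAut.conjNormal t : MulAut N) ↔ (n : G) ∈ Subgroup.center G := by
  rw [mem_fixedPart, Subtype.ext_iff, MulAut.conjNormal_apply, mul_inv_eq_iff_eq_mul]
  refine ⟨fun h => mem_center_of_index_two hN (fun a ha b hb => ?_) ht n.2 h,
    fun h => Subgroup.mem_center_iff.1 h t⟩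
  exact congrArg Subtype.val (mul_comm (⟨a, ha⟩ : N) ⟨b, hb⟩)

theorem fixedPart_conjNormal_eq_top_iff (hN : N.index = 2) {t : G} (ht : t ∉ N) :
    fixedPart (MulAut.conjNormal t : MulAut N) = ⊤ ↔ N ≤ Subgroup.center G := by
  rw [Subgroup.eq_top_iff']
  simp only [mem_fixedPart_conjNormal_iff hN ht]
  exact ⟨fun h n hn => h ⟨n, hn⟩, fun h n => h n.2⟩

theorem fixedPart_conjNormal_eq_bot_iff (hN : N.index = 2) {t : G} (ht : t ∉ N) :
    fixedPart (MulAut.conjNormal t : MulAut N) = ⊥ ↔ Subgroup.center G ⊓ N = ⊥ := by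
  simp only [Subgroup.eq_bot_iff_forall, mem_fixedPart_conjNormal_iff hN ht]
  exact ⟨fun h n hn => congrArg Subtype.val (h ⟨n, hn.2⟩ hn.1),
    fun h n hn => Subtype.ext (h n ⟨hn, n.2⟩)⟩

theorem le_center_iff_forall_prime_le_ncard [Finite G] {p : ℕ} (hp : p.Prime) (hodd : Odd p)
    (hN : N.index = 2) (hcard : Nat.card N = p ^ 2) {t : G} (ht : t ∉ N) (ht2 : t ^ 2 = 1) :
    N ≤ Subgroup.center G ↔ ∀ x, p ≤ ((powerGraph G).neighborSet x).ncard := by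
  refine ⟨fun h => prime_le_ncard_neighborSet hp hodd hN hcard h ht ht2, fun h => ?_⟩
  by_contra hle
  have hcomm : ∀ a ∈ N, ∀ b ∈ N, a * b = b * a := fun a ha b hb =>
    congrArg Subtype.val (mul_comm (⟨a, ha⟩ : N) ⟨b, hb⟩)
  by_cases hbot : Subgroup.center G ⊓ N = ⊥
  · have := ncard_neighborSet_le_one hN hcomm hbot ht ht2
    have := h t
    have := hp.two_le
    omega
  · obtain ⟨x, hxN, hxZ⟩ := SetLike.not_le_iff_exists.1 hle
    refine (h x).not_gt (ncard_neighborSet_lt_prime hp hN hcomm (fun a ha => ?_) hxN hxZ)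
    exact congrArg Subtype.val (pow_prime_eq_one_of_parts hp hodd hcard
      (conjNormal_conjNormal_of_sq_eq_one ht2)
      (mt (fixedPart_conjNormal_eq_bot_iff hN ht).1 hbot)
      (mt (fixedPart_conjNormal_eq_top_iff hN ht).1 hle) ⟨a, ha⟩)

omit [N.Normal] in
theorem center_inf_ne_bot_iff_forall_one_lt_ncard [Finite G] {p : ℕ} (hodd : Odd p)
    (hN : N.index = 2) (hcard : Nat.card N = p ^ 2) {t : G} (ht : t ∉ N) (ht2 : t ^ 2 = 1) :
    Subgroup.center G ⊓ N ≠ ⊥ ↔ ∀ x, 1 < ((powerGraph G).neighborSet x).ncard := by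
  refine ⟨fun h => one_lt_ncard_neighborSet (hcard ▸ hodd.pow) h, fun h hbot => ?_⟩
  refine (h t).not_ge (ncard_neighborSet_le_one hN (fun a ha b hb => ?_) hbot ht ht2)
  exact congrArg Subtype.val (mul_comm (⟨a, ha⟩ : N) ⟨b, hb⟩)

omit [N.Normal] [IsMulCommutative N] in
theorem isCyclic_of_exists_orderOf_eq_prime_sq [Finite G] {p : ℕ} (hodd : Odd p)
    (hN : N.index = 2) (hcard : Nat.card N = p ^ 2) (h : ∃ g : G, orderOf g = p ^ 2) :
    IsCyclic N := by
  obtain ⟨g, hg⟩ := h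
  have hgN : g ∈ N := by
    -- An element of odd order is a square, and squares lie in any subgroup of index two.
    obtain ⟨k, hk⟩ := exists_sq_eq_of_odd_card (B := Subgroup.zpowers g)
      (by rw [Nat.card_zpowers, hg]; exact hodd.pow) ⟨g, Subgroup.mem_zpowers g⟩
    have hk' : (g ^ k) ^ 2 = g := congrArg Subtype.val hk
    exact hk' ▸ Subgroup.sq_mem_of_index_two hN (g ^ k)
  exact isCyclic_of_orderOf_eq_card ⟨g, hgN⟩ (by rw [Subgroup.orderOf_mk, hg, hcard])

omit [N.Normal] [IsMulCommutative N] in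
theorem pow_prime_eq_one_of_forall_orderOf_ne [Finite G] {p : ℕ} (hp : p.Prime)
    (hcard : Nat.card N = p ^ 2) (h : ¬∃ g : G, orderOf g = p ^ 2) (a : N) : a ^ p = 1 := by
  have hdvd : orderOf a ∣ p ^ 2 := hcard ▸ orderOf_dvd_natCard a
  rw [Nat.dvd_prime_pow hp] at hdvd
  obtain ⟨i, hi, hi'⟩ := hdvd
  have hi2 : i ≠ 2 := by
    rintro rfl
    exact h ⟨a, by rw [Subgroup.orderOf_coe, hi']⟩
  rw [← orderOf_dvd_iff_pow_eq_one, hi']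
  simpa using pow_dvd_pow p (show i ≤ 1 by omega)

omit [N.Normal] in
theorem nonempty_mulEquiv_of_orderOf_iff [Finite G] {H : Type v} [Group H] [Finite H]
    {M : Subgroup H} [IsMulCommutative M] {p : ℕ} (hp : p.Prime) (hodd : Odd p)
    (hN : N.index = 2) (hM : M.index = 2) (hcN : Nat.card N = p ^ 2) (hcM : Nat.card M = p ^ 2)
    (h : (∃ g : G, orderOf g = p ^ 2) ↔ ∃ g : H, orderOf g = p ^ 2) : Nonempty (N ≃* M) := by
  have : Fact p.Prime := ⟨hp⟩
  by_cases hg : ∃ g : G, orderOf g = p ^ 2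
  · have := isCyclic_of_exists_orderOf_eq_prime_sq hodd hN hcN hg
    have := isCyclic_of_exists_orderOf_eq_prime_sq hodd hM hcM (h.1 hg)
    exact ⟨mulEquivOfCyclicCardEq (hcN.trans hcM.symm)⟩
  · exact nonempty_mulEquiv_of_pow_prime_eq_one (pow_prime_eq_one_of_forall_orderOf_ne hp hcN hg)
      (pow_prime_eq_one_of_forall_orderOf_ne hp hcM (mt h.2 hg)) (hcN.trans hcM.symm)

/-- If the action is trivial or inversion, every isomorphism commutes with it; otherwise all fixed
and inverted parts have order `p` and can be matched separately. -/
theorem exists_mulEquiv_comm_conjNormal [Finite G] {H : Type v} [Group H] [Finite H]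
    {M : Subgroup H} [M.Normal] [IsMulCommutative M] {p : ℕ} (hp : p.Prime) (hodd : Odd p)
    (hN : N.index = 2) (hM : M.index = 2) (hcN : Nat.card N = p ^ 2) (hcM : Nat.card M = p ^ 2)
    {t : G} {s : H} (ht : t ∉ N) (hs : s ∉ M) (ht2 : t ^ 2 = 1) (hs2 : s ^ 2 = 1)
    (h : (∃ g : G, orderOf g = p ^ 2) ↔ ∃ g : H, orderOf g = p ^ 2)
    (htop : N ≤ Subgroup.center G ↔ M ≤ Subgroup.center H)
    (hbot : Subgroup.center G ⊓ N = ⊥ ↔ Subgroup.center H ⊓ M = ⊥) :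
    ∃ φ : N ≃* M, ∀ n, φ (MulAut.conjNormal t n) = MulAut.conjNormal s (φ n) := by
  have : Fact p.Prime := ⟨hp⟩
  have hσ := conjNormal_conjNormal_of_sq_eq_one (N := N) ht2
  have hτ := conjNormal_conjNormal_of_sq_eq_one (N := M) hs2
  rw [← fixedPart_conjNormal_eq_top_iff hN ht, ← fixedPart_conjNormal_eq_top_iff hM hs] at htop
  rw [← fixedPart_conjNormal_eq_bot_iff hN ht, ← fixedPart_conjNormal_eq_bot_iff hM hs] at hbot
  obtain ⟨φ⟩ := nonempty_mulEquiv_of_orderOf_iff hp hodd hN hM hcN hcM h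
  by_cases h1 : fixedPart (MulAut.conjNormal t : MulAut N) = ⊤
  · refine ⟨φ, fun n => ?_⟩
    rw [mem_fixedPart.1 (h1 ▸ Subgroup.mem_top n),
      mem_fixedPart.1 (htop.1 h1 ▸ Subgroup.mem_top (φ n))]
  by_cases h2 : fixedPart (MulAut.conjNormal t : MulAut N) = ⊥
  · refine ⟨φ, fun n => ?_⟩
    rw [apply_eq_inv_of_fixedPart_eq_bot hσ h2,
      apply_eq_inv_of_fixedPart_eq_bot hτ (hbot.1 h2), map_inv]
  obtain ⟨hC, hD⟩ := card_parts_eq_prime hp hodd hcN hσ h2 h1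
  obtain ⟨hC', hD'⟩ := card_parts_eq_prime hp hodd hcM hτ (mt hbot.2 h2) (mt htop.2 h1)
  exact exists_mulEquiv_comm_of_parts (hcN ▸ hodd.pow) (hcM ▸ hodd.pow) hσ hτ
    (mulEquivOfPrimeCardEq hC hC') (mulEquivOfPrimeCardEq hD hD')

end TwoPrimeSquare

theorem proposition2p1 (p : ℕ) (hp : p.Prime) (hodd : Odd p) :
    2 * p ^ 2 ∈ powerGraphOrders.{u, v} := by
  refine ⟨Nat.mul_pos two_pos (pow_pos hp.pos 2), fun G H _ _ _ _ hG hH ⟨e⟩ => ?_⟩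
  have : Fact p.Prime := ⟨hp⟩
  obtain ⟨N, hN, hcN, t, ht, ht2⟩ := exists_index_two_and_involution hp hodd hG
  obtain ⟨M, hM, hcM, s, hs, hs2⟩ := exists_index_two_and_involution hp hodd hH
  have := Subgroup.normal_of_index_eq_two hN
  have := Subgroup.normal_of_index_eq_two hM
  have := IsPGroup.isMulCommutative_of_card_eq_prime_sq hcN
  have := IsPGroup.isMulCommutative_of_card_eq_prime_sq hcM
  have hclique : (powerGraph G).CliqueFree (p ^ 2) ↔ (powerGraph H).CliqueFree (p ^ 2) :=
    ⟨fun h => h.comap e.symm.isContained, fun h => h.comap e.isContained⟩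
  have hdeg : ∀ k : ℕ, (∀ x, k ≤ ((powerGraph G).neighborSet x).ncard) ↔
      ∀ x, k ≤ ((powerGraph H).neighborSet x).ncard := fun k => by
    rw [← e.toEquiv.forall_congr_right]
    exact forall_congr' fun x => by rw [← ncard_neighborSet_eq_of_iso e x]; rfl
  obtain ⟨φ, hφ⟩ := exists_mulEquiv_comm_conjNormal hp hodd hN hM hcN hcM ht hs ht2 hs2
    (by rw [← not_cliqueFree_powerGraph_iff hp hodd hN hcN,
      ← not_cliqueFree_powerGraph_iff hp hodd hM hcM, hclique])
    (by rw [le_center_iff_forall_prime_le_ncard hp hodd hN hcN ht ht2,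
      le_center_iff_forall_prime_le_ncard hp hodd hM hcM hs hs2, hdeg])
    (by rw [← not_iff_not]
        exact (center_inf_ne_bot_iff_forall_one_lt_ncard hodd hN hcN ht ht2).trans
          ((hdeg 2).trans
            (center_inf_ne_bot_iff_forall_one_lt_ncard hodd hM hcM hs hs2).symm))
  exact nonempty_mulEquiv_of_index_two hN hM ht hs ht2 hs2 φ hφ
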